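/- For $\alpha\in(0,1]$ let $\gamma(\alpha;\eta)=\int_0^\eta e^{-w}w^{\alpha-1}\,dw$ be the lower incomplete gamma function, and let $S_\alpha=\{S_\alpha(t),t\ge 0\}$ be a subordinator (a real Lévy process with almost surely non-decreasing paths) with Laplace exponent $\alpha\gamma(\alpha;\eta)$, that is, $$\mathbb{E}\,e^{-\eta S_\alpha(t)}=e^{-t\alpha\gamma(\alpha;\eta)},\qquad t,\eta\ge 0 .$$ Here $f\sim g$ means $f=g+o(g)$ (so $f/g\to1$ when $g$ is eventually non-zero, and $f$ is eventually zero when $g$ is). 1) Let $\alpha\in(0,1)$. Then for every $t\ge 0$, $$P(S_\alpha(t)>x)\sim\frac{t\,x^{-\alpha}}{\Gamma(1-\alpha)},\qquad x\to+\infty .$$ 2) Let $\alpha\in(0,1]$ and $0<p<\alpha$. Then the fractional moment $\mathbb{E}\,S_\alpha(t)^p$ is finite for every $t\ge 0$, and $$\mathbb{E}\,S_\alpha(t)^p\sim\frac{\Gamma(1-p/\alpha)}{\Gamma(1-p)}\,t^{p/\alpha},\qquad t\to+\infty .$$ In the boundary case $p=\alpha=1$, the moment $\mathbb{E}\,S_1(t)$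 is also finite for every $t\ge0$ and $\mathbb{E}\,S_1(t)\sim t$ as $t\to+\infty$ (the formula above, with the quotient $\Gamma(1-p/\alpha)/\Gamma(1-p)$ replaced by its value $1$ for $\alpha=1$, $p<1$). -/

import Mathlib

open MeasureTheory ProbabilityTheory Filter Topology Asymptotics
open scoped NNReal

/-- A real-valued Lévy process indexed by `[0, ∞)`: it starts at `0`, has independent and
stationary increments, is stochastically continuous, and its paths are almost surely
right-continuous with left limits. -/
structure IsLevyProcess {Ω : Type*} [MeasurableSpace Ω] (X : ℝ≥0 → Ω → ℝ) (P : Measure Ω) :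
    Prop where
  measurable : ∀ t, Measurable (X t)
  zero : ∀ᵐ ω ∂P, X 0 ω = 0
  indepIncrements : HasIndepIncrements X P
  stationaryIncrements : ∀ s h : ℝ≥0,
    IdentDistrib (fun ω ↦ X (s + h) ω - X s ω) (fun ω ↦ X h ω - X 0 ω) P P
  stochasticallyContinuous : ∀ t, TendstoInMeasure P X (𝓝 t) (X t)
  rightContinuous : ∀ᵐ ω ∂P, ∀ t, ContinuousWithinAt (fun s ↦ X s ω) (Set.Ici t) t
  leftLimits : ∀ᵐ ω ∂P, ∀ t, ∃ l : ℝ, Tendsto (fun s ↦ X s ω) (𝓝[<] t) (𝓝 l)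

/-- A subordinator: a Lévy process whose paths are almost surely non-decreasing. -/
structure IsSubordinator {Ω : Type*} [MeasurableSpace Ω] (S : ℝ≥0 → Ω → ℝ) (P : Measure Ω) :
    Prop extends IsLevyProcess S P where
  monotone : ∀ᵐ ω ∂P, Monotone fun t ↦ S t ω

/-- `φ` is the Laplace exponent of `S`: `𝔼 exp(-η S(t)) = exp(-t φ(η))` for `t, η ≥ 0`. -/
def HasLaplaceExponent {Ω : Type*} [MeasurableSpace Ω] (S : ℝ≥0 → Ω → ℝ) (P : Measure Ω)
    (φ : ℝ → ℝ) : Prop :=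
  ∀ (t : ℝ≥0) (η : ℝ), 0 ≤ η →
    ∫ ω, Real.exp (-η * S t ω) ∂P = Real.exp (-(t : ℝ) * φ η)

/-- The lower incomplete gamma function `γ(α; x) = ∫₀ˣ e^{-w} w^{α-1} dw`. -/
noncomputable def lowerIncompleteGamma (α x : ℝ) : ℝ :=
  ∫ w in (0 : ℝ)..x, Real.exp (-w) * w ^ (α - 1)

/-- `S` is a version of the subordinator `S_α`, that is, the subordinator with Laplace exponent
`η ↦ α γ(α; η)`. -/
structure IsIncompleteGammaSubordinator {Ω : Type*} [MeasurableSpace Ω] (α : ℝ)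
    (S : ℝ≥0 → Ω → ℝ) (P : Measure Ω) : Prop extends IsSubordinator S P where
  laplaceExponent : HasLaplaceExponent S P fun η ↦ α * lowerIncompleteGamma α η

/-!
Since `γ(α; η) = ∫₀^η e^{-w} w^{α-1} dw`, the Laplace exponent is equivalent to `η ^ α` as `η → 0+`,
and this is all that matters: `L_t(η) = 𝔼 exp(-η S(t))` satisfies `1 - L_t(η) ~ t η ^ α`.

Tails. The functions `y ↦ x ^ α P(S(t) > x y)` are antitone and their Laplace transforms converge,
as `x → ∞`, to that of `t y ^ (-α) / Γ(1 - α)`. Polynomials in `e ^ (-y)` and the Weierstrass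
theorem turn this into convergence of integrals against compactly supported continuous functions,
and monotonicity turns the latter into convergence at `y = 1`.

Moments. For `Y ≥ 0` and `0 < p < 1`, taking expectations in
`∫₀^∞ (1 - e^{-η Y}) η ^ (-p-1) dη = Γ(1-p)/p · Y ^ p` expresses `𝔼 Y ^ p` through the Laplace
transform of `Y`. The Laplace transform of `t ^ (-1/α) S(t)` tends to `exp (-u ^ α)` as `t → ∞`,
and `1 - L_t(t ^ (-1/α) u) ≤ min 1 (2 u ^ α)` for large `t` allows passing to the limit in the
integral. The mean at `α = 1` is the slope of `1 - L_t` at `0+`.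
-/

section IncompleteGamma

variable {α η : ℝ}

lemma intervalIntegrable_exp_neg_mul_rpow (hα : 0 < α) (a b : ℝ) :
    IntervalIntegrable (fun w : ℝ ↦ Real.exp (-w) * w ^ (α - 1)) volume a b :=
  (intervalIntegral.intervalIntegrable_rpow' (by linarith)).continuousOn_mul (by fun_prop)

lemma mul_integral_rpow_sub_one (hα : 0 < α) (η : ℝ) :
    α * ∫ w in (0 : ℝ)..η, w ^ (α - 1) = η ^ α := by
  rw [integral_rpow (Or.inl (by linarith)), sub_add_cancel, Real.zero_rpow hα.ne', sub_zero,
    mul_div_cancel₀ _ hα.ne']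

lemma mul_lowerIncompleteGamma_le (hα : 0 < α) (hη : 0 ≤ η) :
    α * lowerIncompleteGamma α η ≤ η ^ α := by
  rw [← mul_integral_rpow_sub_one hα η]
  refine mul_le_mul_of_nonneg_left ?_ hα.le
  refine intervalIntegral.integral_mono_on hη (intervalIntegrable_exp_neg_mul_rpow hα 0 η)
    (intervalIntegral.intervalIntegrable_rpow' (by linarith)) fun w hw ↦ ?_
  exact mul_le_of_le_one_left (Real.rpow_nonneg hw.1 _) (Real.exp_le_one_iff.2 (by linarith [hw.1]))

lemma exp_neg_mul_rpow_le_mul_lowerIncompleteGamma (hα : 0 < α) (hη : 0 ≤ η) :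
    Real.exp (-η) * η ^ α ≤ α * lowerIncompleteGamma α η := by
  rw [← mul_integral_rpow_sub_one hα η, mul_left_comm, ← intervalIntegral.integral_const_mul]
  refine mul_le_mul_of_nonneg_left ?_ hα.le
  refine intervalIntegral.integral_mono_on hη
    ((intervalIntegral.intervalIntegrable_rpow' (by linarith)).const_mul _)
    (intervalIntegrable_exp_neg_mul_rpow hα 0 η) fun w hw ↦ ?_
  exact mul_le_mul_of_nonneg_right (Real.exp_le_exp.2 (by linarith [hw.2]))
    (Real.rpow_nonneg hw.1 _)

lemma isEquivalent_mul_lowerIncompleteGamma (hα : 0 < α) :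
    (fun η ↦ α * lowerIncompleteGamma α η) ~[𝓝[>] 0] fun η ↦ η ^ α := by
  have hexp : Tendsto (fun η : ℝ ↦ Real.exp (-η)) (𝓝[>] 0) (𝓝 1) := by
    have h : Continuous fun η : ℝ ↦ Real.exp (-η) := by fun_prop
    simpa using (h.tendsto 0).mono_left nhdsWithin_le_nhds
  refine isEquivalent_of_tendsto_one
    (tendsto_of_tendsto_of_tendsto_of_le_of_le' hexp tendsto_const_nhds ?_ ?_)
  · filter_upwards [self_mem_nhdsWithin] with η (hη : 0 < η)
    exact (le_div_iff₀ (by positivity)).2 (exp_neg_mul_rpow_le_mul_lowerIncompleteGamma hα hη.le)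
  · filter_upwards [self_mem_nhdsWithin] with η (hη : 0 < η)
    exact (div_le_one (by positivity)).2 (mul_lowerIncompleteGamma_le hα hη.le)

end IncompleteGamma

section OneSubExpNeg

open Set

lemma one_sub_exp_neg_isEquivalent : (fun z : ℝ ↦ 1 - Real.exp (-z)) ~[𝓝 0] fun z ↦ z := by
  have hderiv : HasDerivAt (fun z : ℝ ↦ 1 - Real.exp (-z)) 1 0 := by
    simpa using ((hasDerivAt_neg (0 : ℝ)).exp).const_sub 1
  simpa [IsEquivalent, Pi.sub_def] using hderiv.isLittleO

lemma one_sub_exp_neg_nonneg {z : ℝ} (hz : 0 ≤ z) : 0 ≤ 1 - Real.exp (-z) :=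
  sub_nonneg.2 (Real.exp_le_one_iff.2 (neg_nonpos.2 hz))

lemma one_sub_exp_neg_le (z : ℝ) : 1 - Real.exp (-z) ≤ z := by
  linarith [Real.one_sub_le_exp_neg z]

lemma integral_mul_exp_neg_mul (a x : ℝ) :
    ∫ s in (0 : ℝ)..x, a * Real.exp (-(s * a)) = 1 - Real.exp (-(x * a)) := by
  have hderiv (s : ℝ) :
      HasDerivAt (fun s ↦ -Real.exp (-(s * a))) (a * Real.exp (-(s * a))) s := by
    simpa [mul_comm] using (((hasDerivAt_id s).mul_const a).fun_neg.exp).fun_neg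
  rw [intervalIntegral.integral_eq_sub_of_hasDerivAt (fun s _ ↦ hderiv s)
    (Continuous.intervalIntegrable (by fun_prop) _ _)]
  simp only [zero_mul, neg_zero, Real.exp_zero, sub_neg_eq_add, neg_add_eq_sub]

lemma lintegral_Ioc_mul_exp_neg_mul {a x : ℝ} (ha : 0 ≤ a) (hx : 0 ≤ x) :
    ∫⁻ s in Ioc 0 x, ENNReal.ofReal (a * Real.exp (-(s * a)))
      = ENNReal.ofReal (1 - Real.exp (-(x * a))) := by
  have hcont : Continuous fun s : ℝ ↦ a * Real.exp (-(s * a)) := by fun_prop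
  rw [← ofReal_integral_eq_lintegral_ofReal hcont.integrableOn_Ioc
      (.of_forall fun s ↦ by positivity), ← intervalIntegral.integral_of_le hx,
    integral_mul_exp_neg_mul]

lemma lintegral_Ioi_rpow_mul_exp_neg_mul_rpow {q β b : ℝ} (hq : -1 < q) (hβ : 0 < β) (hb : 0 < b) :
    ∫⁻ u in Ioi 0, ENNReal.ofReal (u ^ q * Real.exp (-b * u ^ β))
      = ENNReal.ofReal (b ^ (-(q + 1) / β) * (1 / β) * Real.Gamma ((q + 1) / β)) := by
  rw [← integral_rpow_mul_exp_neg_mul_rpow hβ hq hb, ofReal_integral_eq_lintegral_ofReal]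
  · exact integrableOn_rpow_mul_exp_neg_mul_rpow hq hβ hb
  · filter_upwards [ae_restrict_mem measurableSet_Ioi] with u (hu : 0 < u)
    positivity

lemma lintegral_Ioc_rpow_sub_one {a x : ℝ} (ha : 0 < a) (hx : 0 ≤ x) :
    ∫⁻ s in Ioc 0 x, ENNReal.ofReal (s ^ (a - 1)) = ENNReal.ofReal (x ^ a / a) := by
  rw [← ofReal_integral_eq_lintegral_ofReal, ← intervalIntegral.integral_of_le hx,
    integral_rpow (Or.inl (by linarith)), sub_add_cancel, Real.zero_rpow ha.ne', sub_zero]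
  · exact (intervalIntegral.intervalIntegrable_rpow' (by linarith)).1
  · filter_upwards [ae_restrict_mem measurableSet_Ioc] with s hs
    exact Real.rpow_nonneg hs.1.le _

-- Write `1 - exp (-x u ^ β)` as an integral over `s ∈ (0, x]` and swap the order of integration.
lemma lintegral_one_sub_exp_neg_mul_rpow {p β x : ℝ} (hp : 0 < p) (hpβ : p < β) (hx : 0 ≤ x) :
    ∫⁻ u in Ioi (0 : ℝ), ENNReal.ofReal ((1 - Real.exp (-(x * u ^ β))) * u ^ (-p - 1))
      = ENNReal.ofReal (Real.Gamma (1 - p / β) / p * x ^ (p / β)) := by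
  have hβ : 0 < β := hp.trans hpβ
  have : 0 < Real.Gamma (1 - p / β) :=
    Real.Gamma_pos_of_pos (sub_pos.2 ((div_lt_one hβ).2 hpβ))
  calc _ = ∫⁻ u in Ioi (0 : ℝ), ∫⁻ s in Ioc 0 x,
        ENNReal.ofReal (u ^ (β - p - 1) * Real.exp (-s * u ^ β)) := by
        refine setLIntegral_congr_fun measurableSet_Ioi fun u (hu : 0 < u) ↦ ?_
        have hsplit (s : ℝ) : u ^ (β - p - 1) * Real.exp (-s * u ^ β)
            = u ^ β * Real.exp (-(s * u ^ β)) * u ^ (-p - 1) := by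
          rw [show β - p - 1 = β + (-p - 1) by ring, Real.rpow_add hu, neg_mul]
          ring
        have hu' : 0 ≤ u ^ (-p - 1) := by positivity
        simp only [hsplit, ENNReal.ofReal_mul' hu']
        rw [lintegral_mul_const _ (by fun_prop), lintegral_Ioc_mul_exp_neg_mul (by positivity) hx]
    _ = ∫⁻ s in Ioc 0 x, ∫⁻ u in Ioi (0 : ℝ),
        ENNReal.ofReal (u ^ (β - p - 1) * Real.exp (-s * u ^ β)) :=
        lintegral_lintegral_swap (by simp only [Function.uncurry_def]; fun_prop)
    _ = ∫⁻ s in Ioc 0 x,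
        ENNReal.ofReal (Real.Gamma (1 - p / β) / β) * ENNReal.ofReal (s ^ (p / β - 1)) := by
        refine setLIntegral_congr_fun measurableSet_Ioc fun s hs ↦ ?_
        rw [lintegral_Ioi_rpow_mul_exp_neg_mul_rpow (by linarith) hβ hs.1,
          ← ENNReal.ofReal_mul (by positivity)]
        congr 1
        rw [show -(β - p - 1 + 1) / β = p / β - 1 by field_simp; ring,
          show (β - p - 1 + 1) / β = 1 - p / β by field_simp; ring]
        ring
    _ = _ := by
        rw [lintegral_const_mul _ (by fun_prop), lintegral_Ioc_rpow_sub_one (by positivity) hx,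
          ← ENNReal.ofReal_mul (by positivity)]
        congr 1
        field_simp

lemma integral_one_sub_exp_neg_rpow {p β : ℝ} (hp : 0 < p) (hpβ : p < β) :
    ∫ u in Ioi (0 : ℝ), (1 - Real.exp (-(u ^ β))) * u ^ (-p - 1) = Real.Gamma (1 - p / β) / p := by
  have : 0 < Real.Gamma (1 - p / β) :=
    Real.Gamma_pos_of_pos (sub_pos.2 ((div_lt_one (hp.trans hpβ)).2 hpβ))
  have hlintegral := lintegral_one_sub_exp_neg_mul_rpow hp hpβ zero_le_one
  simp only [one_mul, Real.one_rpow, mul_one] at hlintegral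
  rw [integral_eq_lintegral_of_nonneg_ae, hlintegral, ENNReal.toReal_ofReal (by positivity)]
  · filter_upwards [ae_restrict_mem measurableSet_Ioi] with u (hu : 0 < u)
    exact mul_nonneg (one_sub_exp_neg_nonneg (by positivity)) (by positivity)
  · fun_prop

lemma integrableOn_mul_rpow_of_isBigO {f : ℝ → ℝ} {p α : ℝ} (hf : ContinuousOn f (Ioi 0))
    (htop : f =O[atTop] fun _ ↦ (1 : ℝ)) (hzero : f =O[𝓝[>] 0] fun η ↦ η ^ α) (hp : 0 < p)
    (hpα : p < α) : IntegrableOn (fun η ↦ f η * η ^ (-p - 1)) (Ioi 0) := by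
  simpa only [mul_comm] using mellin_convergent_of_isBigO_scalar (s := -p) (a := 0) (b := -α)
    (hf.locallyIntegrableOn measurableSet_Ioi) (by simpa using htop) (by linarith)
    (by simpa using hzero) (by linarith)

end OneSubExpNeg

section LaplaceTransform

open Set

variable {Ω : Type*} [MeasurableSpace Ω] {P : Measure Ω} {Y : Ω → ℝ} {η p : ℝ}

lemma integrable_exp_neg_mul [IsFiniteMeasure P] (hY : AEMeasurable Y P) (hY0 : 0 ≤ᵐ[P] Y)
    (hη : 0 ≤ η) : Integrable (fun ω ↦ Real.exp (-η * Y ω)) P := by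
  simpa using integrable_exp_mul_of_le η 0 hη hY.neg (hY0.mono fun ω hω ↦ neg_nonpos.2 hω)

lemma continuousOn_mgf_neg [IsFiniteMeasure P] (hY : AEMeasurable Y P) (hY0 : 0 ≤ᵐ[P] Y) :
    ContinuousOn (fun η ↦ mgf Y P (-η)) (Ioi 0) := by
  refine continuousOn_mgf.comp continuousOn_neg fun η (hη : 0 < η) ↦ ?_
  have hsubset : Iio 0 ⊆ integrableExpSet Y P := fun t (ht : t < 0) ↦ by
    simpa [integrableExpSet] using integrable_exp_neg_mul hY hY0 (neg_nonneg.2 ht.le)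
  exact interior_maximal hsubset isOpen_Iio (neg_lt_zero.2 hη)

lemma antitone_measureReal_lt [IsFiniteMeasure P] : Antitone fun y ↦ P.real {ω | y < Y ω} :=
  fun _ _ h ↦ measureReal_mono fun _ hω ↦ h.trans_lt hω

lemma integrableOn_exp_neg_mul_measureReal_lt [IsFiniteMeasure P] (hη : 0 < η) :
    IntegrableOn (fun y ↦ Real.exp (-(η * y)) * P.real {ω | y < Y ω}) (Ioi 0) := by
  have hexp : IntegrableOn (fun y ↦ Real.exp (-(η * y))) (Ioi 0) := by
    simpa only [neg_mul] using exp_neg_integrableOn_Ioi 0 hη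
  have hmeas : Measurable fun y ↦ P.real {ω | y < Y ω} := antitone_measureReal_lt.measurable
  refine hexp.mul_bdd (c := P.real univ) hmeas.aestronglyMeasurable (.of_forall fun y ↦ ?_)
  simpa only [Real.norm_of_nonneg measureReal_nonneg] using measureReal_mono (subset_univ _)

variable [IsProbabilityMeasure P]

lemma lintegral_one_sub_exp_neg_mul (hY : AEMeasurable Y P) (hY0 : 0 ≤ᵐ[P] Y) (hη : 0 ≤ η) :
    ∫⁻ ω, ENNReal.ofReal (1 - Real.exp (-(η * Y ω))) ∂P = ENNReal.ofReal (1 - mgf Y P (-η)) := by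
  have hint := integrable_exp_neg_mul hY hY0 hη
  simp only [← neg_mul]
  have hint' : Integrable (fun ω ↦ 1 - Real.exp (-η * Y ω)) P := (integrable_const 1).sub hint
  rw [← ofReal_integral_eq_lintegral_ofReal hint', integral_sub (integrable_const 1) hint]
  · simp [mgf]
  · filter_upwards [hY0] with ω hω
    simpa using mul_nonneg hη hω

lemma mgf_neg_le_one (hY : AEMeasurable Y P) (hY0 : 0 ≤ᵐ[P] Y) (hη : 0 ≤ η) :
    mgf Y P (-η) ≤ 1 := by
  calc mgf Y P (-η) ≤ ∫ _, 1 ∂P :=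
        integral_mono_ae (integrable_exp_neg_mul hY hY0 hη) (integrable_const 1) <| by
          filter_upwards [hY0] with ω hω
          simpa using mul_nonneg hη hω
    _ = 1 := by simp

lemma lintegral_rpow_eq_lintegral_mgf (hY : AEMeasurable Y P) (hY0 : 0 ≤ᵐ[P] Y) (hp₀ : 0 < p)
    (hp₁ : p < 1) :
    ENNReal.ofReal (Real.Gamma (1 - p) / p) * ∫⁻ ω, ENNReal.ofReal (Y ω ^ p) ∂P
      = ∫⁻ η in Ioi 0, ENNReal.ofReal ((1 - mgf Y P (-η)) * η ^ (-p - 1)) := by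
  have : 0 < Real.Gamma (1 - p) := Real.Gamma_pos_of_pos (by linarith)
  have hmeas : AEMeasurable (fun z : Ω × ℝ ↦
      ENNReal.ofReal ((1 - Real.exp (-(Y z.1 * z.2))) * z.2 ^ (-p - 1)))
      (P.prod (volume.restrict (Ioi 0))) := by
    have : AEMeasurable (fun z : Ω × ℝ ↦ Y z.1) (P.prod (volume.restrict (Ioi 0))) :=
      hY.comp_fst
    fun_prop
  calc _ = ∫⁻ ω, (∫⁻ η in Ioi 0,
        ENNReal.ofReal ((1 - Real.exp (-(Y ω * η))) * η ^ (-p - 1))) ∂P := by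
        rw [← lintegral_const_mul' _ _ ENNReal.ofReal_ne_top]
        refine lintegral_congr_ae (hY0.mono fun ω (hω : 0 ≤ Y ω) ↦ ?_)
        have h := lintegral_one_sub_exp_neg_mul_rpow hp₀ hp₁ hω
        simp only [Real.rpow_one, div_one] at h
        simp only [h, ENNReal.ofReal_mul (show 0 ≤ Real.Gamma (1 - p) / p by positivity)]
    _ = ∫⁻ η in Ioi (0 : ℝ), ∫⁻ ω,
        ENNReal.ofReal ((1 - Real.exp (-(Y ω * η))) * η ^ (-p - 1)) ∂P :=
        lintegral_lintegral_swap hmeas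
    _ = _ := by
        refine setLIntegral_congr_fun measurableSet_Ioi fun η (hη : 0 < η) ↦ ?_
        have hpow : 0 ≤ η ^ (-p - 1) := by positivity
        simp only [ENNReal.ofReal_mul' hpow, mul_comm _ η]
        rw [lintegral_mul_const' _ _ ENNReal.ofReal_ne_top,
          lintegral_one_sub_exp_neg_mul hY hY0 hη.le]

lemma aestronglyMeasurable_one_sub_mgf_neg_mul_rpow (hY : AEMeasurable Y P) (hY0 : 0 ≤ᵐ[P] Y)
    (q : ℝ) : AEStronglyMeasurable (fun η ↦ (1 - mgf Y P (-η)) * η ^ q)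
      (volume.restrict (Ioi 0)) := by
  have hmgf := (continuousOn_mgf_neg hY hY0).aestronglyMeasurable (μ := volume) measurableSet_Ioi
  exact (aestronglyMeasurable_const.sub hmgf).mul (by fun_prop)

lemma integral_rpow_eq_integral_mgf (hY : AEMeasurable Y P) (hY0 : 0 ≤ᵐ[P] Y) (hp₀ : 0 < p)
    (hp₁ : p < 1) :
    Real.Gamma (1 - p) / p * ∫ ω, Y ω ^ p ∂P
      = ∫ η in Ioi 0, (1 - mgf Y P (-η)) * η ^ (-p - 1) := by
  have : 0 < Real.Gamma (1 - p) := Real.Gamma_pos_of_pos (by linarith)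
  have hnonneg : 0 ≤ᵐ[volume.restrict (Ioi 0)] fun η ↦ (1 - mgf Y P (-η)) * η ^ (-p - 1) := by
    filter_upwards [ae_restrict_mem measurableSet_Ioi] with η (hη : 0 < η)
    exact mul_nonneg (sub_nonneg.2 (mgf_neg_le_one hY hY0 hη.le)) (by positivity)
  rw [integral_eq_lintegral_of_nonneg_ae (hY0.mono fun ω hω ↦ Real.rpow_nonneg hω p)
      (hY.pow_const p).aestronglyMeasurable,
    integral_eq_lintegral_of_nonneg_ae hnonneg
      (aestronglyMeasurable_one_sub_mgf_neg_mul_rpow hY hY0 _),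
    ← lintegral_rpow_eq_lintegral_mgf hY hY0 hp₀ hp₁, ENNReal.toReal_mul,
    ENNReal.toReal_ofReal (by positivity)]

lemma integrableOn_one_sub_mgf_neg_mul_rpow (hY : AEMeasurable Y P) (hY0 : 0 ≤ᵐ[P] Y) {α : ℝ}
    (hp₀ : 0 < p) (hpα : p < α)
    (hO : (fun η ↦ 1 - mgf Y P (-η)) =O[𝓝[>] 0] fun η ↦ η ^ α) :
    IntegrableOn (fun η ↦ (1 - mgf Y P (-η)) * η ^ (-p - 1)) (Ioi 0) := by
  refine integrableOn_mul_rpow_of_isBigO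
    (continuousOn_const.sub (continuousOn_mgf_neg hY hY0)) (.of_bound 1 ?_) hO hp₀ hpα
  filter_upwards [eventually_ge_atTop 0] with η hη
  have h : 0 ≤ mgf Y P (-η) := mgf_nonneg
  simpa [abs_of_nonneg (sub_nonneg.2 (mgf_neg_le_one hY hY0 hη))] using h

lemma integrable_rpow_of_one_sub_mgf_isBigO (hY : AEMeasurable Y P) (hY0 : 0 ≤ᵐ[P] Y) {α : ℝ}
    (hp₀ : 0 < p) (hp₁ : p < 1) (hpα : p < α)
    (hO : (fun η ↦ 1 - mgf Y P (-η)) =O[𝓝[>] 0] fun η ↦ η ^ α) :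
    Integrable (fun ω ↦ Y ω ^ p) P := by
  have hΓ : 0 < Real.Gamma (1 - p) / p := div_pos (Real.Gamma_pos_of_pos (by linarith)) hp₀
  have hfin := (integrableOn_one_sub_mgf_neg_mul_rpow hY hY0 hp₀ hpα hO).lintegral_lt_top
  rw [← lintegral_rpow_eq_lintegral_mgf hY hY0 hp₀ hp₁] at hfin
  refine (lintegral_ofReal_ne_top_iff_integrable (hY.pow_const p).aestronglyMeasurable
    (hY0.mono fun ω hω ↦ Real.rpow_nonneg hω p)).1 fun htop ↦ hfin.ne ?_
  rw [htop, ENNReal.mul_top (ENNReal.ofReal_pos.2 hΓ).ne']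


lemma integral_rpow_eq_integral_mgf_mul (hY : AEMeasurable Y P) (hY0 : 0 ≤ᵐ[P] Y) (hp₀ : 0 < p)
    (hp₁ : p < 1) {r : ℝ} (hr : 0 ≤ r) :
    Real.Gamma (1 - p) / p * (r ^ p * ∫ ω, Y ω ^ p ∂P)
      = ∫ η in Ioi 0, (1 - mgf Y P (-(r * η))) * η ^ (-p - 1) := by
  have h := integral_rpow_eq_integral_mgf (hY.const_mul r)
    (hY0.mono fun ω hω ↦ mul_nonneg hr hω) hp₀ hp₁
  simp only [mgf_const_mul, mul_neg] at h
  rw [← h, ← integral_const_mul]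
  congr 1
  refine integral_congr_ae (hY0.mono fun ω hω ↦ ?_)
  exact (Real.mul_rpow hr hω).symm

lemma tendsto_one_sub_exp_neg_mul_div (y : ℝ) :
    Tendsto (fun η ↦ (1 - Real.exp (-(η * y))) / η) (𝓝[>] 0) (𝓝 y) := by
  have hderiv : HasDerivAt (fun η ↦ 1 - Real.exp (-(η * y))) y 0 := by
    simpa using (((hasDerivAt_id (0 : ℝ)).mul_const y).fun_neg.exp).const_sub 1
  simpa [inv_mul_eq_div] using hderiv.tendsto_slope_zero_right

-- Fatou gives `≤`, and `1 - exp (-η Y) ≤ η Y` gives `≥`.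
lemma lintegral_eq_of_tendsto_one_sub_mgf_div (hY : AEMeasurable Y P) (hY0 : 0 ≤ᵐ[P] Y) {c : ℝ}
    (hc : Tendsto (fun η ↦ (1 - mgf Y P (-η)) / η) (𝓝[>] 0) (𝓝 c)) :
    ∫⁻ ω, ENNReal.ofReal (Y ω) ∂P = ENNReal.ofReal c := by
  have hquot (η : ℝ) (hη : 0 < η) :
      ∫⁻ ω, ENNReal.ofReal ((1 - Real.exp (-(η * Y ω))) / η) ∂P
        = ENNReal.ofReal ((1 - mgf Y P (-η)) / η) := by
    simp only [div_eq_mul_inv, ENNReal.ofReal_mul' (inv_nonneg.2 hη.le)]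
    rw [lintegral_mul_const' _ _ ENNReal.ofReal_ne_top, lintegral_one_sub_exp_neg_mul hY hY0 hη.le]
  have hlim : Tendsto (fun η ↦ ∫⁻ ω, ENNReal.ofReal ((1 - Real.exp (-(η * Y ω))) / η) ∂P)
      (𝓝[>] 0) (𝓝 (ENNReal.ofReal c)) :=
    (ENNReal.tendsto_ofReal hc).congr' <| eventually_mem_nhdsWithin.mono
      fun η hη ↦ (hquot η hη).symm
  refine le_antisymm ?_ (le_of_tendsto hlim ?_)
  · calc ∫⁻ ω, ENNReal.ofReal (Y ω) ∂P
        = ∫⁻ ω, liminf (fun η : ℝ ↦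
            ENNReal.ofReal ((1 - Real.exp (-(η * Y ω))) / η)) (𝓝[>] 0) ∂P :=
          lintegral_congr fun ω ↦
            (ENNReal.tendsto_ofReal (tendsto_one_sub_exp_neg_mul_div (Y ω))).liminf_eq.symm
      _ ≤ liminf (fun η : ℝ ↦ ∫⁻ ω,
            ENNReal.ofReal ((1 - Real.exp (-(η * Y ω))) / η) ∂P) (𝓝[>] 0) :=
          lintegral_liminf_le' fun η ↦ by fun_prop
      _ = ENNReal.ofReal c := hlim.liminf_eq
  · filter_upwards [self_mem_nhdsWithin] with η (hη : 0 < η)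
    exact lintegral_mono fun ω ↦ ENNReal.ofReal_le_ofReal <|
      (div_le_iff₀' hη).2 (one_sub_exp_neg_le _)

lemma integrable_and_integral_eq_of_one_sub_mgf_isEquivalent (hY : AEMeasurable Y P)
    (hY0 : 0 ≤ᵐ[P] Y) {c : ℝ}
    (hc : (fun η ↦ 1 - mgf Y P (-η)) ~[𝓝[>] 0] fun η ↦ c * η) :
    Integrable Y P ∧ ∫ ω, Y ω ∂P = c := by
  have hlim : Tendsto (fun η ↦ (1 - mgf Y P (-η)) / η) (𝓝[>] 0) (𝓝 c) := by
    have h := hc.div (.refl (u := fun η : ℝ ↦ η))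
    refine h.symm.tendsto_nhds (tendsto_const_nhds.congr' ?_)
    filter_upwards [self_mem_nhdsWithin] with η (hη : 0 < η)
    exact (mul_div_cancel_right₀ c hη.ne').symm
  have hc₀ : 0 ≤ c := ge_of_tendsto hlim <| by
    filter_upwards [self_mem_nhdsWithin] with η (hη : 0 < η)
    exact div_nonneg (sub_nonneg.2 (mgf_neg_le_one hY hY0 hη.le)) hη.le
  have hlintegral := lintegral_eq_of_tendsto_one_sub_mgf_div hY hY0 hlim
  refine ⟨(lintegral_ofReal_ne_top_iff_integrable hY.aestronglyMeasurable hY0).1 ?_, ?_⟩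
  · exact hlintegral ▸ ENNReal.ofReal_ne_top
  · rw [integral_eq_lintegral_of_nonneg_ae hY0 hY.aestronglyMeasurable, hlintegral,
      ENNReal.toReal_ofReal hc₀]

lemma lintegral_exp_neg_mul_measureReal_lt (hY : AEMeasurable Y P) (hY0 : 0 ≤ᵐ[P] Y)
    (hη : 0 ≤ η) :
    ∫⁻ y in Ioi 0, ENNReal.ofReal (P.real {ω | y < Y ω} * (η * Real.exp (-(y * η))))
      = ENNReal.ofReal (1 - mgf Y P (-η)) := by
  have hcake := lintegral_comp_eq_lintegral_meas_lt_mul P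
    (g := fun y ↦ η * Real.exp (-(y * η))) hY0 hY
    (fun _ _ ↦ Continuous.intervalIntegrable (by fun_prop) _ _) (.of_forall fun y ↦ by positivity)
  simp only [integral_mul_exp_neg_mul, mul_comm (Y _) η,
    lintegral_one_sub_exp_neg_mul hY hY0 hη] at hcake
  simp only [hcake, ENNReal.ofReal_mul measureReal_nonneg,
    ofReal_measureReal (measure_ne_top P _)]

lemma integral_exp_neg_mul_measureReal_lt (hY : AEMeasurable Y P) (hY0 : 0 ≤ᵐ[P] Y)
    (hη : 0 < η) :
    ∫ y in Ioi 0, Real.exp (-(η * y)) * P.real {ω | y < Y ω} = (1 - mgf Y P (-η)) / η := by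
  have hmeas : Measurable fun y ↦ P.real {ω | y < Y ω} := antitone_measureReal_lt.measurable
  have hlintegral := lintegral_exp_neg_mul_measureReal_lt hY hY0 hη.le
  rw [eq_div_iff hη.ne', ← integral_mul_const]
  calc _ = ∫ y in Ioi 0, P.real {ω | y < Y ω} * (η * Real.exp (-(y * η))) := by
        refine integral_congr_ae (.of_forall fun y ↦ ?_)
        simp only [mul_comm y η]
        ring
    _ = 1 - mgf Y P (-η) := by
        rw [integral_eq_lintegral_of_nonneg_ae (.of_forall fun y ↦ by positivity) (by fun_prop),
          hlintegral, ENNReal.toReal_ofReal (sub_nonneg.2 (mgf_neg_le_one hY hY0 hη.le))]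

end LaplaceTransform

section Tauberian

open Set

variable {E ι : Type*} [MeasurableSpace E] {μ : Measure E} {l : Filter ι}

section Moments

variable {e H G : E → ℝ} {F : ι → E → ℝ} {f g : ℝ → ℝ} {a b δ : ℝ}

lemma integrable_comp_mul (he : AEMeasurable e μ) (heab : ∀ᵐ x ∂μ, e x ∈ Icc a b)
    (hg : Continuous g) (hH : Integrable H μ) : Integrable (fun x ↦ g (e x) * H x) μ := by
  obtain ⟨C, hC⟩ := isCompact_Icc.exists_bound_of_continuousOn (hg.continuousOn (s := Icc a b))
  exact hH.bdd_mul (c := C) (hg.measurable.comp_aemeasurable he).aestronglyMeasurable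
    (heab.mono fun x hx ↦ hC _ hx)

lemma abs_integral_comp_mul_sub_le (he : AEMeasurable e μ) (heab : ∀ᵐ x ∂μ, e x ∈ Icc a b)
    (hf : Continuous f) (hg : Continuous g) (hfg : ∀ v ∈ Icc a b, |f v - g v| ≤ δ)
    (hH : Integrable H μ) (hH0 : 0 ≤ᵐ[μ] H) :
    |∫ x, f (e x) * H x ∂μ - ∫ x, g (e x) * H x ∂μ| ≤ δ * ∫ x, H x ∂μ := by
  rw [← integral_sub (integrable_comp_mul he heab hf hH) (integrable_comp_mul he heab hg hH),
    ← integral_const_mul, ← Real.norm_eq_abs]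
  refine norm_integral_le_of_norm_le (hH.const_mul δ) ?_
  filter_upwards [heab, hH0] with x hx (hHx : 0 ≤ H x)
  rw [← sub_mul, norm_mul, Real.norm_of_nonneg hHx]
  exact mul_le_mul_of_nonneg_right (hfg _ hx) hHx

lemma integral_eval_mul_eq_sum (he : AEMeasurable e μ) (heab : ∀ᵐ x ∂μ, e x ∈ Icc a b)
    (q : Polynomial ℝ) (hH : Integrable H μ) :
    ∫ x, q.eval (e x) * H x ∂μ
      = ∑ k ∈ Finset.range (q.natDegree + 1), q.coeff k * ∫ x, e x ^ k * H x ∂μ := by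
  simp only [Polynomial.eval_eq_sum_range, Finset.sum_mul, mul_assoc]
  rw [integral_finsetSum]
  · simp only [integral_const_mul]
  · exact fun k _ ↦ (integrable_comp_mul he heab (continuous_pow k) hH).const_mul _

-- By Weierstrass, `g` is uniformly close on `[a, b]` to a polynomial.
lemma tendsto_integral_comp_mul_of_tendsto_moments (he : AEMeasurable e μ)
    (heab : ∀ᵐ x ∂μ, e x ∈ Icc a b) (hF : ∀ᶠ i in l, Integrable (F i) μ)
    (hF0 : ∀ᶠ i in l, 0 ≤ᵐ[μ] F i) (hG : Integrable G μ) (hG0 : 0 ≤ᵐ[μ] G)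
    (hmoments : ∀ k : ℕ,
      Tendsto (fun i ↦ ∫ x, e x ^ k * F i x ∂μ) l (𝓝 (∫ x, e x ^ k * G x ∂μ)))
    (hg : Continuous g) :
    Tendsto (fun i ↦ ∫ x, g (e x) * F i x ∂μ) l (𝓝 (∫ x, g (e x) * G x ∂μ)) := by
  have hpoly (q : Polynomial ℝ) : Tendsto (fun i ↦ ∫ x, q.eval (e x) * F i x ∂μ) l
      (𝓝 (∫ x, q.eval (e x) * G x ∂μ)) := by
    rw [integral_eval_mul_eq_sum he heab q hG]
    exact (tendsto_finsetSum _ fun k _ ↦ (hmoments k).const_mul _).congr' <|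
      hF.mono fun i hi ↦ (integral_eval_mul_eq_sum he heab q hi).symm
  have hmass : Tendsto (fun i ↦ ∫ x, F i x ∂μ) l (𝓝 (∫ x, G x ∂μ)) := by simpa using hmoments 0
  set M := ∫ x, G x ∂μ
  have hM : 0 ≤ M := integral_nonneg_of_ae hG0
  refine Metric.tendsto_nhds.2 fun ε hε ↦ ?_
  obtain ⟨δ, hδ, hδε⟩ : ∃ δ > 0, δ * M + 0 + δ * M < ε := by
    refine ⟨ε / (2 * M + 1), by positivity, ?_⟩
    calc _ = ε * (2 * M / (2 * M + 1)) := by ring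
      _ < ε := mul_lt_of_lt_one_right hε ((div_lt_one (by positivity)).2 (lt_add_one _))
  obtain ⟨q, hq⟩ := exists_polynomial_near_of_continuousOn a b g hg.continuousOn δ hδ
  have hclose {H : E → ℝ} :=
    abs_integral_comp_mul_sub_le (H := H) he heab q.continuous hg (fun v hv ↦ (hq v hv).le)
  have hbound := ((hmass.const_mul δ).add
    (tendsto_iff_dist_tendsto_zero.1 (hpoly q))).add_const (δ * M)
  filter_upwards [hF, hF0, hbound.eventually_lt_const hδε] with i hi hi0 hlt
  refine lt_of_le_of_lt ?_ hlt
  refine (dist_triangle4 _ (∫ x, q.eval (e x) * F i x ∂μ) (∫ x, q.eval (e x) * G x ∂μ) _).trans ?_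
  rw [dist_comm (∫ x, g (e x) * F i x ∂μ)]
  exact add_le_add_three (hclose hi hi0) le_rfl (hclose hG hG0)

end Moments

variable {F : ι → ℝ → ℝ} {G w : ℝ → ℝ}

lemma continuous_comp_neg_log_div (hw : Continuous w) (hwc : HasCompactSupport w) :
    Continuous fun v ↦ w (-Real.log v) / v := by
  refine continuous_iff_continuousAt.2 fun v ↦ ?_
  rcases eq_or_ne v 0 with rfl | hv
  · have hzero : w =ᶠ[atTop] 0 := (hasCompactSupport_iff_eventuallyEq.1 hwc).filter_mono
      (coclosedCompact_eq_cocompact (X := ℝ) ▸ atTop_le_cocompact)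
    have hev : ∀ᶠ v in 𝓝[≠] 0, w (-Real.log v) / v = 0 :=
      (tendsto_neg_atBot_atTop.comp Real.tendsto_log_nhdsNE_zero |>.eventually hzero).mono
        fun v hv ↦ by simp [show w (-Real.log v) = 0 from hv]
    refine continuousAt_const.congr (f := fun _ ↦ 0) ?_
    filter_upwards [eventually_nhdsWithin_iff.1 hev] with v hv
    by_cases h : v = 0
    · simp [h]
    · exact (hv h).symm
  · exact (hw.continuousAt.comp (Real.continuousAt_log hv).neg).div continuousAt_id hv

-- With `v = exp (-y)`, Laplace transforms at the integers are the moments of `v` on `(0, 1)`.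
lemma tendsto_integral_mul_of_tendsto_laplace
    (hF : ∀ᶠ i in l, IntegrableOn (fun y ↦ Real.exp (-y) * F i y) (Ioi 0))
    (hF0 : ∀ᶠ i in l, ∀ y > 0, 0 ≤ F i y)
    (hG : IntegrableOn (fun y ↦ Real.exp (-y) * G y) (Ioi 0)) (hG0 : ∀ y > 0, 0 ≤ G y)
    (hlaplace : ∀ η > 0, Tendsto (fun i ↦ ∫ y in Ioi 0, Real.exp (-(η * y)) * F i y) l
      (𝓝 (∫ y in Ioi 0, Real.exp (-(η * y)) * G y)))
    (hw : Continuous w) (hwc : HasCompactSupport w) :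
    Tendsto (fun i ↦ ∫ y in Ioi 0, w y * F i y) l (𝓝 (∫ y in Ioi 0, w y * G y)) := by
  have hexp (y : ℝ) (hy : 0 < y) : Real.exp (-y) ∈ Icc (0 : ℝ) 1 :=
    ⟨(Real.exp_pos _).le, Real.exp_le_one_iff.2 (by linarith)⟩
  have hpow (k : ℕ) (H : ℝ → ℝ) (y : ℝ) :
      Real.exp (-y) ^ k * (Real.exp (-y) * H y) = Real.exp (-((k + 1 : ℝ) * y)) * H y := by
    rw [← mul_assoc, ← pow_succ, ← Real.exp_nat_mul]
    push_cast
    ring_nf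
  have htest (H : ℝ → ℝ) (y : ℝ) :
      w (-Real.log (Real.exp (-y))) / Real.exp (-y) * (Real.exp (-y) * H y) = w y * H y := by
    rw [Real.log_exp, neg_neg, ← mul_assoc, div_mul_cancel₀ _ (Real.exp_pos _).ne']
  have hnonneg {H : ℝ → ℝ} (hH : ∀ y > 0, 0 ≤ H y) :
      0 ≤ᵐ[volume.restrict (Ioi 0)] fun y ↦ Real.exp (-y) * H y := by
    filter_upwards [ae_restrict_mem measurableSet_Ioi] with y hy
    exact mul_nonneg (Real.exp_pos _).le (hH y hy)
  have h := tendsto_integral_comp_mul_of_tendsto_moments (e := fun y ↦ Real.exp (-y))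
    (F := fun i y ↦ Real.exp (-y) * F i y) (by fun_prop)
    ((ae_restrict_mem measurableSet_Ioi).mono hexp) hF (hF0.mono fun i hi ↦ hnonneg hi) hG
    (hnonneg hG0) (fun k ↦ by simpa only [hpow] using hlaplace (k + 1) (by positivity))
    (continuous_comp_neg_log_div hw hwc)
  simpa only [htest] using h

lemma exists_continuous_integral_eq_one {a b : ℝ} (hab : a < b) :
    ∃ w : ℝ → ℝ, Continuous w ∧ 0 ≤ w ∧ tsupport w ⊆ Icc a b ∧ ∫ y, w y = 1 := by
  let φ : ContDiffBump ((a + b) / 2) := ⟨(b - a) / 4, (b - a) / 2, by linarith, by linarith⟩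
  refine ⟨φ.normed volume, φ.continuous_normed, φ.nonneg_normed, ?_, φ.integral_normed⟩
  rw [φ.tsupport_normed_eq, Real.closedBall_eq_Icc]
  exact Icc_subset_Icc (by simp only [φ]; linarith) (by simp only [φ]; linarith)

lemma integral_mul_mem_Icc_of_antitoneOn {a b : ℝ} (hab : a ≤ b) (hG : AntitoneOn G (Icc a b))
    (hw : Continuous w) (hw0 : 0 ≤ w) (hsupp : tsupport w ⊆ Icc a b) (hone : ∫ y, w y = 1) :
    ∫ y, w y * G y ∈ Icc (G b) (G a) := by
  have hzero {y : ℝ} (hy : y ∉ Icc a b) : w y = 0 :=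
    image_eq_zero_of_notMem_tsupport (hy <| hsupp ·)
  have hint : Integrable w := hw.integrable_of_hasCompactSupport
    (isCompact_Icc.of_isClosed_subset (isClosed_tsupport w) hsupp)
  have hintG : Integrable fun y ↦ w y * G y := by
    refine (integrableOn_iff_integrable_of_support_subset fun y hy ↦ ?_).1
      ((hG.integrableOn_isCompact isCompact_Icc).continuousOn_mul hw.continuousOn isCompact_Icc)
    by_contra h
    exact hy (by simp [hzero h])
  have hbetween (y : ℝ) : w y * G b ≤ w y * G y ∧ w y * G y ≤ w y * G a := by
    by_cases hy : y ∈ Icc a b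
    · exact ⟨mul_le_mul_of_nonneg_left (hG hy (right_mem_Icc.2 hab) hy.2) (hw0 y),
        mul_le_mul_of_nonneg_left (hG (left_mem_Icc.2 hab) hy hy.1) (hw0 y)⟩
    · simp [hzero hy]
  have hconst (c : ℝ) : ∫ y, w y * c = c := by rw [integral_mul_const, hone, one_mul]
  refine ⟨?_, ?_⟩
  · rw [← hconst (G b)]
    exact integral_mono (hint.mul_const _) hintG fun y ↦ (hbetween y).1
  · rw [← hconst (G a)]
    exact integral_mono hintG (hint.mul_const _) fun y ↦ (hbetween y).2

lemma exists_forall_antitoneOn_setIntegral_mul_mem_Icc {a b : ℝ} (ha : 0 < a) (hab : a < b) :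
    ∃ w : ℝ → ℝ, Continuous w ∧ HasCompactSupport w ∧
      ∀ H : ℝ → ℝ, AntitoneOn H (Ioi 0) → ∫ y in Ioi 0, w y * H y ∈ Icc (H b) (H a) := by
  obtain ⟨w, hw, hw0, hsupp, hone⟩ := exists_continuous_integral_eq_one hab
  have hpos : Icc a b ⊆ Ioi 0 := fun y hy ↦ ha.trans_le hy.1
  refine ⟨w, hw, isCompact_Icc.of_isClosed_subset (isClosed_tsupport w) hsupp, fun H hH ↦ ?_⟩
  rw [setIntegral_eq_integral_of_forall_compl_eq_zero fun y hy ↦ by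
    rw [image_eq_zero_of_notMem_tsupport fun h ↦ hy (hpos (hsupp h)), zero_mul]]
  exact integral_mul_mem_Icc_of_antitoneOn hab.le (hH.mono hpos) hw hw0 hsupp hone

lemma tendsto_of_tendsto_integral_mul_of_antitoneOn
    (hF : ∀ᶠ i in l, AntitoneOn (F i) (Ioi 0)) (hG : AntitoneOn G (Ioi 0))
    (hvague : ∀ w : ℝ → ℝ, Continuous w → HasCompactSupport w →
      Tendsto (fun i ↦ ∫ y in Ioi 0, w y * F i y) l (𝓝 (∫ y in Ioi 0, w y * G y)))
    {x : ℝ} (hx : 0 < x) (hGx : ContinuousAt G x) : Tendsto (fun i ↦ F i x) l (𝓝 (G x)) := by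
  refine tendsto_order.2 ⟨fun c hc ↦ ?_, fun c hc ↦ ?_⟩
  · obtain ⟨b, hcb, hxb⟩ : ∃ b, c < G b ∧ x < b :=
      (((hGx.eventually_const_lt hc).filter_mono nhdsWithin_le_nhds).and
        (self_mem_nhdsWithin (s := Ioi x))).exists
    obtain ⟨w, hw, hwc, hbracket⟩ := exists_forall_antitoneOn_setIntegral_mul_mem_Icc hx hxb
    filter_upwards [hF, (hvague w hw hwc).eventually_const_lt (hcb.trans_le (hbracket G hG).1)]
      with i hi hlt
    exact hlt.trans_le (hbracket _ hi).2
  · obtain ⟨a, hac, ha, hax⟩ : ∃ a, G a < c ∧ 0 < a ∧ a < x :=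
      (((hGx.eventually_lt_const hc).filter_mono nhdsWithin_le_nhds).and
        (Ioo_mem_nhdsLT hx)).exists
    obtain ⟨w, hw, hwc, hbracket⟩ := exists_forall_antitoneOn_setIntegral_mul_mem_Icc ha hax
    filter_upwards [hF, (hvague w hw hwc).eventually_lt_const ((hbracket G hG).2.trans_lt hac)]
      with i hi hlt
    exact (hbracket _ hi).1.trans_lt hlt

variable {Ω : Type*} [MeasurableSpace Ω] {P : Measure Ω} {Y : Ω → ℝ} {α c : ℝ}

lemma integral_exp_neg_mul_mul_rpow_neg (hα₁ : α < 1) (c : ℝ) {η : ℝ} (hη : 0 < η) :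
    ∫ y in Ioi 0, Real.exp (-(η * y)) * (c * y ^ (-α) / Real.Gamma (1 - α)) = c * η ^ (α - 1) := by
  have hΓ : Real.Gamma (1 - α) ≠ 0 := (Real.Gamma_pos_of_pos (by linarith)).ne'
  have hgamma := Real.integral_rpow_mul_exp_neg_mul_Ioi (show 0 < 1 - α by linarith) hη
  rw [show 1 - α - 1 = -α by ring, one_div, Real.inv_rpow hη.le, ← Real.rpow_neg hη.le,
    neg_sub] at hgamma
  calc _ = ∫ y in Ioi 0, c / Real.Gamma (1 - α) * (y ^ (-α) * Real.exp (-(η * y))) := by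
        congr with y
        ring
    _ = c * η ^ (α - 1) := by
        rw [integral_const_mul, hgamma]
        field_simp

lemma integrableOn_exp_neg_mul_mul_rpow_neg (hα₁ : α < 1) (c : ℝ) :
    IntegrableOn (fun y ↦ Real.exp (-y) * (c * y ^ (-α) / Real.Gamma (1 - α))) (Ioi 0) := by
  have h := (Real.GammaIntegral_convergent (show 0 < 1 - α by linarith)).const_mul
    (c / Real.Gamma (1 - α))
  refine h.congr (.of_forall fun y ↦ ?_)
  simp only [show 1 - α - 1 = -α by ring]
  ring

lemma tendsto_rpow_mul_one_sub_mgf_div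
    (h : (fun η ↦ 1 - mgf Y P (-η)) ~[𝓝[>] 0] fun η ↦ c * η ^ α) {η : ℝ} (hη : 0 < η) :
    Tendsto (fun x ↦ x ^ α * (1 - mgf Y P (-(x⁻¹ * η))) / η) atTop (𝓝 (c * η ^ (α - 1))) := by
  have hto : Tendsto (fun x : ℝ ↦ x⁻¹ * η) atTop (𝓝[>] 0) := by
    refine tendsto_nhdsWithin_iff.2 ⟨by simpa using tendsto_inv_atTop_zero.mul_const η, ?_⟩
    filter_upwards [eventually_gt_atTop 0] with x hx
    exact mul_pos (inv_pos.2 hx) hη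
  have hequiv := ((IsEquivalent.refl (u := fun x : ℝ ↦ x ^ α)).mul (h.comp_tendsto hto)).div
    (.refl (u := fun _ ↦ η))
  refine hequiv.symm.tendsto_nhds (tendsto_const_nhds.congr' ?_)
  filter_upwards [eventually_gt_atTop 0] with x hx
  simp only [Pi.div_apply, Pi.mul_apply, Function.comp_apply,
    Real.mul_rpow (inv_nonneg.2 hx.le) hη.le, Real.inv_rpow hx.le, Real.rpow_sub_one hη.ne']
  field_simp

variable [IsProbabilityMeasure P]

lemma integral_exp_neg_mul_mul_measureReal_lt_inv_mul (hY : AEMeasurable Y P) (hY0 : 0 ≤ᵐ[P] Y)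
    (r : ℝ) {x η : ℝ} (hx : 0 < x) (hη : 0 < η) :
    ∫ y in Ioi 0, Real.exp (-(η * y)) * (r * P.real {ω | y < x⁻¹ * Y ω})
      = r * (1 - mgf Y P (-(x⁻¹ * η))) / η := by
  have hscale := integral_exp_neg_mul_measureReal_lt (hY.const_mul x⁻¹)
    (hY0.mono fun ω hω ↦ mul_nonneg (inv_nonneg.2 hx.le) hω) hη
  rw [mgf_const_mul, mul_neg] at hscale
  simp only [mul_left_comm _ r]
  rw [integral_const_mul, hscale, mul_div_assoc]

lemma tendsto_rpow_mul_measureReal_lt (hY : AEMeasurable Y P) (hY0 : 0 ≤ᵐ[P] Y) (hα₀ : 0 ≤ α)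
    (hα₁ : α < 1) (hc : 0 ≤ c)
    (h : (fun η ↦ 1 - mgf Y P (-η)) ~[𝓝[>] 0] fun η ↦ c * η ^ α) :
    Tendsto (fun x ↦ x ^ α * P.real {ω | x < Y ω}) atTop (𝓝 (c / Real.Gamma (1 - α))) := by
  have : 0 < Real.Gamma (1 - α) := Real.Gamma_pos_of_pos (by linarith)
  have hx0 : ∀ᶠ x : ℝ in atTop, 0 < x := eventually_gt_atTop 0
  let F (x y : ℝ) : ℝ := x ^ α * P.real {ω | y < x⁻¹ * Y ω}
  let G (y : ℝ) : ℝ := c * y ^ (-α) / Real.Gamma (1 - α)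
  have hFint : ∀ᶠ x in atTop, IntegrableOn (fun y ↦ Real.exp (-y) * F x y) (Ioi 0) :=
    .of_forall fun x ↦ by
      have h : IntegrableOn (fun y ↦ Real.exp (-(1 * y)) * P.real {ω | y < x⁻¹ * Y ω}) (Ioi 0) :=
        integrableOn_exp_neg_mul_measureReal_lt one_pos
      refine (h.const_mul (x ^ α)).congr (.of_forall fun y ↦ ?_)
      simp only [F, one_mul, mul_left_comm]
  have hlaplace (η : ℝ) (hη : 0 < η) : Tendsto (fun x ↦ ∫ y in Ioi 0, Real.exp (-(η * y)) * F x y)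
      atTop (𝓝 (∫ y in Ioi 0, Real.exp (-(η * y)) * G y)) := by
    rw [integral_exp_neg_mul_mul_rpow_neg hα₁ c hη]
    refine (tendsto_rpow_mul_one_sub_mgf_div h hη).congr' (hx0.mono fun x hx ↦ ?_)
    exact (integral_exp_neg_mul_mul_measureReal_lt_inv_mul hY hY0 _ hx hη).symm
  have hFanti : ∀ᶠ x in atTop, AntitoneOn (F x) (Ioi 0) := hx0.mono fun x hx ↦
    (antitone_measureReal_lt.const_mul (Real.rpow_nonneg hx.le α)).antitoneOn _
  have hGanti : AntitoneOn G (Ioi 0) := fun y hy z _ hyz ↦ by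
    have hpow : z ^ (-α) ≤ y ^ (-α) := Real.rpow_le_rpow_of_nonpos hy hyz (by linarith)
    simp only [G]
    gcongr
  have hlim := tendsto_of_tendsto_integral_mul_of_antitoneOn hFanti hGanti
    (fun w ↦ tendsto_integral_mul_of_tendsto_laplace hFint
      (hx0.mono fun x hx y _ ↦ by positivity) (integrableOn_exp_neg_mul_mul_rpow_neg hα₁ c)
      (fun y (hy : 0 < y) ↦ by positivity) hlaplace)
    one_pos (show ContinuousAt G 1 by fun_prop (disch := simp))
  simp only [G, Real.one_rpow, mul_one] at hlim
  refine hlim.congr' (hx0.mono fun x hx ↦ ?_)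
  simp only [F, lt_inv_mul_iff₀ hx, mul_one]

theorem measureReal_lt_isEquivalent_of_one_sub_mgf_isEquivalent (hY : AEMeasurable Y P)
    (hY0 : 0 ≤ᵐ[P] Y) (hα₀ : 0 ≤ α) (hα₁ : α < 1) (hc : 0 ≤ c)
    (h : (fun η ↦ 1 - mgf Y P (-η)) ~[𝓝[>] 0] fun η ↦ c * η ^ α) :
    (fun x ↦ P.real {ω | x < Y ω}) ~[atTop] fun x ↦ c * x ^ (-α) / Real.Gamma (1 - α) := by
  have : 0 < Real.Gamma (1 - α) := Real.Gamma_pos_of_pos (by linarith)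
  rcases hc.eq_or_lt with rfl | hc
  · simp only [zero_mul, zero_div] at h ⊢
    obtain ⟨hint, hmean⟩ :=
      integrable_and_integral_eq_of_one_sub_mgf_isEquivalent (c := 0) hY hY0 (by simpa using h)
    have hzero : Y =ᵐ[P] 0 := (integral_eq_zero_iff_of_nonneg_ae hY0 hint).1 hmean
    refine isEquivalent_zero_iff_eventually_zero.2 ?_
    filter_upwards [eventually_ge_atTop 0] with x hx
    rw [Pi.zero_apply, measureReal_eq_zero_iff, measure_eq_zero_iff_ae_notMem]
    filter_upwards [hzero] with ω hω
    simpa [hω] using hx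
  · have hlim := tendsto_rpow_mul_measureReal_lt hY hY0 hα₀ hα₁ hc.le h
    have hone := hlim.div_const (c / Real.Gamma (1 - α))
    rw [div_self (by positivity)] at hone
    refine isEquivalent_of_tendsto_one (hone.congr' ?_)
    filter_upwards [eventually_gt_atTop 0] with x hx
    simp only [Pi.div_apply, Real.rpow_neg hx.le]
    field_simp

end Tauberian

section Subordinator

open Set

variable {Ω : Type*} [MeasurableSpace Ω] {P : Measure Ω} {S : ℝ≥0 → Ω → ℝ} {φ : ℝ → ℝ} {α p : ℝ}

lemma IsSubordinator.ae_nonneg (hS : IsSubordinator S P) (t : ℝ≥0) : 0 ≤ᵐ[P] S t := by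
  filter_upwards [hS.zero, hS.monotone] with ω hzero hmono
  rw [Pi.zero_apply, ← hzero]
  exact hmono (zero_le (a := t))

lemma tendsto_coe_rpow_neg_inv (hα : 0 < α) :
    Tendsto (fun t : ℝ≥0 ↦ (t : ℝ) ^ (-α⁻¹)) atTop (𝓝[>] 0) := by
  refine tendsto_nhdsWithin_iff.2 ⟨(tendsto_rpow_neg_atTop (inv_pos.2 hα)).comp
    (NNReal.tendsto_coe_atTop.2 tendsto_id), ?_⟩
  filter_upwards [eventually_gt_atTop 0] with t ht
  exact Real.rpow_pos_of_pos ht _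

lemma mul_rpow_neg_inv_mul_rpow (hα : α ≠ 0) {t u : ℝ} (ht : 0 < t) (hu : 0 ≤ u) :
    t * (t ^ (-α⁻¹) * u) ^ α = u ^ α := by
  rw [Real.mul_rpow (by positivity) hu, ← Real.rpow_mul ht.le, neg_mul, inv_mul_cancel₀ hα,
    Real.rpow_neg_one, mul_inv_cancel_left₀ ht.ne']

lemma tendsto_mul_comp_rpow_neg_inv_mul (hα : 0 < α) (hφ : φ ~[𝓝[>] 0] fun η ↦ η ^ α) {u : ℝ}
    (hu : 0 < u) :
    Tendsto (fun t : ℝ≥0 ↦ t * φ ((t : ℝ) ^ (-α⁻¹) * u)) atTop (𝓝 (u ^ α)) := by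
  have hscale : Tendsto (fun t : ℝ≥0 ↦ (t : ℝ) ^ (-α⁻¹) * u) atTop (𝓝[>] 0) := by
    obtain ⟨hzero, hpos⟩ := tendsto_nhdsWithin_iff.1 (tendsto_coe_rpow_neg_inv hα)
    refine tendsto_nhdsWithin_iff.2 ⟨by simpa only [zero_mul] using hzero.mul_const u, ?_⟩
    exact hpos.mono fun t ht ↦ mul_pos ht hu
  have hequiv := (IsEquivalent.refl (u := fun t : ℝ≥0 ↦ (t : ℝ))).mul (hφ.comp_tendsto hscale)
  refine hequiv.symm.tendsto_nhds (tendsto_const_nhds.congr' ?_)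
  filter_upwards [eventually_gt_atTop 0] with t ht
  exact (mul_rpow_neg_inv_mul_rpow hα.ne' ht hu.le).symm

lemma eventually_forall_mul_comp_rpow_neg_inv_mul_le (hα : 0 < α)
    (hφ : φ ~[𝓝[>] 0] fun η ↦ η ^ α) :
    ∀ᶠ t : ℝ≥0 in atTop, ∀ u ∈ Ioo (0 : ℝ) 1, t * φ ((t : ℝ) ^ (-α⁻¹) * u) ≤ 2 * u ^ α := by
  have hle : ∀ᶠ η in 𝓝[>] 0, φ η ≤ 2 * η ^ α := by
    filter_upwards [hφ.isLittleO.bound one_pos, self_mem_nhdsWithin] with η hη (hη₀ : 0 < η)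
    have hpow : 0 ≤ η ^ α := by positivity
    rw [Pi.sub_apply, one_mul, Real.norm_of_nonneg hpow] at hη
    linarith [le_of_abs_le hη]
  obtain ⟨δ, hδ, hsubset⟩ := mem_nhdsGT_iff_exists_Ioo_subset.1 hle
  filter_upwards [eventually_gt_atTop 0,
    (tendsto_coe_rpow_neg_inv hα).eventually (Ioo_mem_nhdsGT hδ)] with t ht hr u hu
  calc t * φ ((t : ℝ) ^ (-α⁻¹) * u) ≤ t * (2 * ((t : ℝ) ^ (-α⁻¹) * u) ^ α) :=
        mul_le_mul_of_nonneg_left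
          (hsubset ⟨mul_pos hr.1 hu.1, (mul_lt_of_lt_one_right hr.1 hu.2).trans hr.2⟩) t.2
    _ = 2 * u ^ α := by
        rw [mul_left_comm, mul_rpow_neg_inv_mul_rpow hα.ne' (NNReal.coe_pos.2 ht) hu.1.le]

namespace HasLaplaceExponent

lemma mgf_neg (hS : HasLaplaceExponent S P φ) (t : ℝ≥0) {η : ℝ} (hη : 0 ≤ η) :
    mgf (S t) P (-η) = Real.exp (-(t * φ η)) := by
  rw [← neg_mul]
  exact hS t η hη

lemma aemeasurable (hS : HasLaplaceExponent S P φ) (t : ℝ≥0) : AEMeasurable (S t) P := by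
  have hint : Integrable (fun ω ↦ Real.exp (-1 * S t ω)) P := by
    by_contra h
    exact (Real.exp_pos _).ne' ((hS t 1 zero_le_one).symm.trans (integral_undef h))
  exact Real.aemeasurable_of_aemeasurable_exp_mul (by norm_num) hint.aemeasurable

lemma one_sub_mgf_isEquivalent (hS : HasLaplaceExponent S P φ) (hα : 0 < α)
    (hφ : φ ~[𝓝[>] 0] fun η ↦ η ^ α) (t : ℝ≥0) :
    (fun η ↦ 1 - mgf (S t) P (-η)) ~[𝓝[>] 0] fun η ↦ t * η ^ α := by
  have hpow : Tendsto (fun η : ℝ ↦ η ^ α) (𝓝[>] 0) (𝓝 0) := by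
    simpa [Real.zero_rpow hα.ne'] using
      ((Real.continuousAt_rpow_const 0 α (.inr hα.le)).tendsto).mono_left nhdsWithin_le_nhds
  have hzero : Tendsto (fun η ↦ t * φ η) (𝓝[>] 0) (𝓝 0) := by
    simpa using (hφ.symm.tendsto_nhds hpow).const_mul (t : ℝ)
  refine ((one_sub_exp_neg_isEquivalent.comp_tendsto hzero).trans
    (.mul (.refl (u := fun _ ↦ (t : ℝ))) hφ)).congr_left ?_
  filter_upwards [self_mem_nhdsWithin] with η (hη : 0 < η)
  simp only [Function.comp_apply, hS.mgf_neg t hη.le]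

lemma eventually_forall_one_sub_mgf_le (hS : HasLaplaceExponent S P φ) (hα : 0 < α)
    (hφ : φ ~[𝓝[>] 0] fun η ↦ η ^ α) :
    ∀ᶠ t in atTop, ∀ u > 0, 1 - mgf (S t) P (-((t : ℝ) ^ (-α⁻¹) * u)) ≤ min 1 (2 * u ^ α) := by
  filter_upwards [eventually_forall_mul_comp_rpow_neg_inv_mul_le hα hφ] with t ht u hu
  have hle_one : 1 - mgf (S t) P (-((t : ℝ) ^ (-α⁻¹) * u)) ≤ 1 := sub_le_self _ mgf_nonneg
  refine le_min hle_one ?_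
  rcases lt_or_ge u 1 with hu₁ | hu₁
  · rw [hS.mgf_neg t (by positivity)]
    exact (one_sub_exp_neg_le _).trans (ht u ⟨hu, hu₁⟩)
  · linarith [Real.one_le_rpow hu₁ hα.le]

variable [IsProbabilityMeasure P]

lemma tendsto_integral_one_sub_mgf (hS : HasLaplaceExponent S P φ) (hS0 : ∀ t, 0 ≤ᵐ[P] S t)
    (hα : 0 < α) (hφ : φ ~[𝓝[>] 0] fun η ↦ η ^ α) (hp₀ : 0 < p) (hpα : p < α) :
    Tendsto (fun t : ℝ≥0 ↦
        ∫ u in Ioi 0, (1 - mgf (S t) P (-((t : ℝ) ^ (-α⁻¹) * u))) * u ^ (-p - 1))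
      atTop (𝓝 (Real.Gamma (1 - p / α) / p)) := by
  have hbound : IntegrableOn (fun u : ℝ ↦ min 1 (2 * u ^ α) * u ^ (-p - 1)) (Ioi 0) := by
    refine integrableOn_mul_rpow_of_isBigO (by fun_prop (disch := grind)) (.of_bound 1 ?_)
      (.of_bound 2 ?_) hp₀ hpα
    · filter_upwards [eventually_ge_atTop 0] with u hu
      simp [abs_of_nonneg (show 0 ≤ min 1 (2 * u ^ α) by positivity)]
    · filter_upwards [self_mem_nhdsWithin] with u (hu : 0 < u)
      rw [Real.norm_of_nonneg (by positivity), Real.norm_of_nonneg (by positivity)]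
      exact min_le_right _ _
  rw [← integral_one_sub_exp_neg_rpow hp₀ hpα]
  refine tendsto_integral_filter_of_dominated_convergence _ (.of_forall fun t ↦ ?_) ?_ hbound ?_
  · simpa only [mgf_const_mul, mul_neg] using aestronglyMeasurable_one_sub_mgf_neg_mul_rpow
      ((hS.aemeasurable t).const_mul ((t : ℝ) ^ (-α⁻¹)))
      ((hS0 t).mono fun ω hω ↦ mul_nonneg (by positivity) hω) (-p - 1)
  · filter_upwards [hS.eventually_forall_one_sub_mgf_le hα hφ] with t ht
    filter_upwards [ae_restrict_mem measurableSet_Ioi] with u (hu : 0 < u)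
    have hnonneg : 0 ≤ 1 - mgf (S t) P (-((t : ℝ) ^ (-α⁻¹) * u)) :=
      sub_nonneg.2 (mgf_neg_le_one (hS.aemeasurable t) (hS0 t) (by positivity))
    rw [Real.norm_of_nonneg (by positivity)]
    exact mul_le_mul_of_nonneg_right (ht u hu) (by positivity)
  · filter_upwards [ae_restrict_mem measurableSet_Ioi] with u (hu : 0 < u)
    have hmgf (t : ℝ≥0) : mgf (S t) P (-((t : ℝ) ^ (-α⁻¹) * u))
        = Real.exp (-(t * φ ((t : ℝ) ^ (-α⁻¹) * u))) := hS.mgf_neg t (by positivity)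
    simp only [hmgf]
    exact (((Real.continuous_exp.tendsto _).comp
      (tendsto_mul_comp_rpow_neg_inv_mul hα hφ hu).neg).const_sub 1).mul_const _

theorem integral_rpow_isEquivalent (hS : HasLaplaceExponent S P φ) (hS0 : ∀ t, 0 ≤ᵐ[P] S t)
    (hα : 0 < α) (hφ : φ ~[𝓝[>] 0] fun η ↦ η ^ α) (hp₀ : 0 < p) (hp₁ : p < 1) (hpα : p < α) :
    (fun t : ℝ≥0 ↦ ∫ ω, S t ω ^ p ∂P) ~[atTop]
      fun t : ℝ≥0 ↦ Real.Gamma (1 - p / α) / Real.Gamma (1 - p) * (t : ℝ) ^ (p / α) := by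
  have hΓ : 0 < Real.Gamma (1 - p) := Real.Gamma_pos_of_pos (by linarith)
  have hΓα : 0 < Real.Gamma (1 - p / α) :=
    Real.Gamma_pos_of_pos (sub_pos.2 ((div_lt_one hα).2 hpα))
  have hlim := (isEquivalent_const_iff_tendsto (div_pos hΓα hp₀).ne').2
    (hS.tendsto_integral_one_sub_mgf hS0 hα hφ hp₀ hpα)
  refine ((hlim.mul (.refl (u := fun t : ℝ≥0 ↦
    p / Real.Gamma (1 - p) * (t : ℝ) ^ (p / α)))).congr_left ?_).congr_right ?_
  · filter_upwards [eventually_gt_atTop 0] with t ht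
    have ht : (0 : ℝ) < t := ht
    have hcancel : ((t : ℝ) ^ (-α⁻¹)) ^ p * (t : ℝ) ^ (p / α) = 1 := by
      rw [← Real.rpow_mul ht.le, ← Real.rpow_add ht, ← Real.rpow_zero (t : ℝ)]
      ring_nf
    simp only [Pi.mul_apply, ← integral_rpow_eq_integral_mgf_mul (hS.aemeasurable t) (hS0 t) hp₀
      hp₁ (Real.rpow_nonneg ht.le _)]
    generalize ((t : ℝ) ^ (-α⁻¹)) ^ p = A at hcancel ⊢
    field_simp
    linear_combination (∫ ω, S t ω ^ p ∂P) * hcancel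
  · filter_upwards with t
    simp only [Pi.mul_apply, Function.const_apply]
    field_simp

end HasLaplaceExponent

end Subordinator

theorem theorem2_general {Ω : Type*} [MeasurableSpace Ω] (P : Measure Ω) [IsProbabilityMeasure P]
    (α : ℝ) (hα₀ : 0 < α) (hα₁ : α ≤ 1) (S : ℝ≥0 → Ω → ℝ) (φ : ℝ → ℝ)
    (hS0 : ∀ t, 0 ≤ᵐ[P] S t) (hS : HasLaplaceExponent S P φ)
    (hφ : φ ~[𝓝[>] 0] fun η ↦ η ^ α) :
    (α < 1 → ∀ t : ℝ≥0,
      (fun x : ℝ ↦ P.real {ω | x < S t ω}) ~[atTop]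
        (fun x : ℝ ↦ (t : ℝ) * x ^ (-α) / Real.Gamma (1 - α))) ∧
    (∀ p : ℝ, 0 < p → p < α →
      (∀ t : ℝ≥0, Integrable (fun ω ↦ S t ω ^ p) P) ∧
      (fun t : ℝ≥0 ↦ ∫ ω, S t ω ^ p ∂P) ~[atTop]
        (fun t : ℝ≥0 ↦ Real.Gamma (1 - p / α) / Real.Gamma (1 - p) * (t : ℝ) ^ (p / α))) ∧
    (α = 1 →
      (∀ t : ℝ≥0, Integrable (S t) P) ∧
      (fun t : ℝ≥0 ↦ ∫ ω, S t ω ∂P) ~[atTop] (fun t : ℝ≥0 ↦ (t : ℝ))) := by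
  have hlaplace := hS.one_sub_mgf_isEquivalent hα₀ hφ
  refine ⟨fun hα t ↦ ?_, fun p hp₀ hpα ↦ ⟨fun t ↦ ?_, ?_⟩, ?_⟩
  · exact measureReal_lt_isEquivalent_of_one_sub_mgf_isEquivalent (hS.aemeasurable t) (hS0 t)
      hα₀.le hα t.2 (hlaplace t)
  · exact integrable_rpow_of_one_sub_mgf_isBigO (hS.aemeasurable t) (hS0 t) hp₀
      (hpα.trans_le hα₁) hpα ((hlaplace t).isBigO.trans (isBigO_const_mul_self _ _ _))
  · exact hS.integral_rpow_isEquivalent hS0 hα₀ hφ hp₀ (hpα.trans_le hα₁) hpα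
  · rintro rfl
    simp only [Real.rpow_one] at hlaplace
    have hmean t := integrable_and_integral_eq_of_one_sub_mgf_isEquivalent (hS.aemeasurable t)
      (hS0 t) (hlaplace t)
    exact ⟨fun t ↦ (hmean t).1, by simp only [(hmean _).2]; rfl⟩

theorem theorem2 {Ω : Type*} [MeasurableSpace Ω] (P : Measure Ω) [IsProbabilityMeasure P]
    (α : ℝ) (hα₀ : 0 < α) (hα₁ : α ≤ 1) (S : ℝ≥0 → Ω → ℝ)
    (hS : IsIncompleteGammaSubordinator α S P) :
    (α < 1 → ∀ t : ℝ≥0,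
      (fun x : ℝ ↦ P.real {ω | x < S t ω}) ~[atTop]
        (fun x : ℝ ↦ (t : ℝ) * x ^ (-α) / Real.Gamma (1 - α))) ∧
    (∀ p : ℝ, 0 < p → p < α →
      (∀ t : ℝ≥0, Integrable (fun ω ↦ S t ω ^ p) P) ∧
      (fun t : ℝ≥0 ↦ ∫ ω, S t ω ^ p ∂P) ~[atTop]
        (fun t : ℝ≥0 ↦ Real.Gamma (1 - p / α) / Real.Gamma (1 - p) * (t : ℝ) ^ (p / α))) ∧
    (α = 1 →
      (∀ t : ℝ≥0, Integrable (S t) P) ∧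
      (fun t : ℝ≥0 ↦ ∫ ω, S t ω ∂P) ~[atTop] (fun t : ℝ≥0 ↦ (t : ℝ))) :=
  theorem2_general P α hα₀ hα₁ S _ hS.ae_nonneg hS.laplaceExponent
    (isEquivalent_mul_lowerIncompleteGamma hα₀)
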